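/- Let $k$ be a field of characteristic zero, $n\ge 0$, and let $A\in\mathrm{GL}_n(k(z))$, where $k(z)$ carries the automorphism $\sigma(h(z))=h(z+1)$. Let $X=\mathbb{A}^1_k\times\mathrm{GL}_{n,k}=\operatorname{Spec}k[z,Z_{ij},1/\det Z]$ and let $\sigma\colon X\dashrightarrow X$ be the rational map $\sigma(b,B)=(b+1,A(b)B)$. Let $U\subseteq X$ be the largest open subset on which $\sigma$ is defined as a map to $X$; for $x\in X(k)$ the orbit of $x$ is said to be defined if $x,\sigma(x),\sigma^2(x),\dots$ all lie in $U$. Put $\mathbb{N}=\{0,1,2,\dots\}$ and call a set $j+\mathbb{N}l$ with $j,l\in\mathbb{N}$ an arithmetic progression (one-point sets, $l=0$, are allowed). Let $\mathrm{Seq}_k$ be the ring of sequences $\mathbb{N}\to k$ with componentwise operations, two sequences being identified if they agree at all sufficiently large arguments. It is a difference ring under the left shift $\sigma(f)(i)=f(i+1)$, and it is a $k(z)$-algebra through the morphism of difference rings $h\mapsto(h(0),h(1),h(2),\dots)$. A *Picard–Vessiot extension of $k(z)$ for $\sigma(y)=Ay$ inside $\mathrm{Seq}_k$* is a $k(z)$-subalgebra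 $L\subseteq\mathrm{Seq}_k$ with $\sigma(L)\subseteq L$ such that - $L$ is a $\sigma$-pseudo field: there are $l\ge1$ and orthogonal idempotents $e_0,\dots,e_{l-1}\in L$ with $L=e_0L\oplus\dots\oplus e_{l-1}L$, $\sigma(e_0)=e_1,\dots,\sigma(e_{l-2})=e_{l-1},\ \sigma(e_{l-1})=e_0$, and every ring $e_iL$ a field; - there is $Y\in\mathrm{GL}_n(L)$ with $\sigma(Y)=AY$ such that $L$ is the total ring of fractions of $k(z)[Y_{ij}]$; - every $x\in L$ with $\sigma(x)=x$ comes from an element of $k(z)$ fixed by $\sigma$. Then the following three statements are equivalent: 1. For every $x=(b,B)\in X(k)$ with $b\in\mathbb{N}$ whose orbit is defined and every closed subvariety $Y\subseteq X$ (Zariski closed subset, not necessarily irreducible), the set $\{i\in\mathbb{N}\mid\sigma^i(x)\in Y\}$ is a finite union of arithmetic progressions. 2. There exists a point $x=(b,B)\in X(k)$ with $b\in\mathbb{N}$ whose orbit is defined such that for every closed subvariety $Y\subseteq X$ the set $\{i\in\mathbb{N}\mid\sigma^i(x)\in Y\}$ is a finite union of arithmetic progressions. 3. There exists a Picard–Vessiot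 extension of $k(z)$ for $\sigma(y)=Ay$ inside $\mathrm{Seq}_k$. -/

import Mathlib

open Polynomial

/-! ### Rational self-maps of an affine integral variety and their orbits -/

namespace AffineRationalMap

variable {k R : Type*} [Field k] [CommRing R] [Algebra k R]

/-- The closed point of `Spec R` underlying a `k`-point `x : R → k`. -/
def toPrime (x : R →ₐ[k] k) : PrimeSpectrum R :=
  ⟨RingHom.ker x, RingHom.ker_isPrime x⟩

/-- A rational map from `X = Spec R` to itself is given by its comorphism
`φ : R → Frac R = k(X)`. It is a morphism on the basic open set `D(s)` if `φ` takes values in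
`R[1/s]`. -/
def IsDefinedOnBasicOpen (φ : R →ₐ[k] FractionRing R) (s : R) : Prop :=
  ∀ f : R, ∃ (a : R) (m : ℕ),
    φ f * algebraMap R (FractionRing R) (s ^ m) = algebraMap R (FractionRing R) a

/-- The largest open subset of `X = Spec R` on which the rational map is defined. -/
def domain (φ : R →ₐ[k] FractionRing R) : TopologicalSpace.Opens (PrimeSpectrum R) :=
  ⨆ s : {s : R // IsDefinedOnBasicOpen φ s}, PrimeSpectrum.basicOpen s.1

open Classical in
/-- The value at the `k`-point `x` of a rational function `g = a / s` with `s(x) ≠ 0`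
(`0` if `g` is not regular at `x`). On an integral domain it does not depend on `a` and `s`. -/
noncomputable def valueAt (x : R →ₐ[k] k) (g : FractionRing R) : k :=
  if h : ∃ p : R × R, x p.2 ≠ 0 ∧
      g * algebraMap R (FractionRing R) p.2 = algebraMap R (FractionRing R) p.1 then
    x h.choose.1 / x h.choose.2
  else 0

theorem valueAt_eq (x : R →ₐ[k] k) {g : FractionRing R} {a s : R} (hs : x s ≠ 0)
    (h : g * algebraMap R (FractionRing R) s = algebraMap R (FractionRing R) a) :
    valueAt x g = x a / x s := by
  have hex : ∃ p : R × R, x p.2 ≠ 0 ∧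
      g * algebraMap R (FractionRing R) p.2 = algebraMap R (FractionRing R) p.1 := ⟨(a, s), hs, h⟩
  rw [valueAt, dif_pos hex]
  obtain ⟨h1, h2⟩ := hex.choose_spec
  rw [div_eq_div_iff h1 hs, ← map_mul, ← map_mul]
  congr 1
  apply IsFractionRing.injective R (FractionRing R)
  rw [map_mul, map_mul, ← h, ← h2]
  ring

theorem exists_fraction {φ : R →ₐ[k] FractionRing R} {x : R →ₐ[k] k}
    (hx : toPrime x ∈ domain φ) (f : R) :
    ∃ a s : R, x s ≠ 0 ∧
      φ f * algebraMap R (FractionRing R) s = algebraMap R (FractionRing R) a := by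
  obtain ⟨⟨s, hs⟩, hxs⟩ := TopologicalSpace.Opens.mem_iSup.mp hx
  obtain ⟨a, m, h⟩ := hs f
  refine ⟨a, s ^ m, ?_, h⟩
  have : x s ≠ 0 := fun h0 => hxs (RingHom.mem_ker.mpr h0)
  rw [map_pow]
  exact pow_ne_zero m this

/-- The image of a `k`-point in the domain of the rational map: `f ↦ (φ f)(x)`. -/
noncomputable def image (φ : R →ₐ[k] FractionRing R) (x : R →ₐ[k] k)
    (hx : toPrime x ∈ domain φ) : R →ₐ[k] k where
  toFun f := valueAt x (φ f)
  map_one' := by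
    rw [valueAt_eq x (a := 1) (s := 1) (by simp) (by simp)]; simp
  map_zero' := by
    rw [valueAt_eq x (a := 0) (s := 1) (by simp) (by simp)]; simp
  map_mul' f g := by
    obtain ⟨a, s, hs, h⟩ := exists_fraction hx f
    obtain ⟨b, t, ht, h'⟩ := exists_fraction hx g
    rw [valueAt_eq x hs h, valueAt_eq x ht h',
      valueAt_eq x (a := a * b) (s := s * t) (by simp [hs, ht])
        (by rw [map_mul, map_mul, map_mul, ← h, ← h']; ring)]
    rw [map_mul, map_mul, div_mul_div_comm]
  map_add' f g := by
    obtain ⟨a, s, hs, h⟩ := exists_fraction hx f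
    obtain ⟨b, t, ht, h'⟩ := exists_fraction hx g
    rw [valueAt_eq x hs h, valueAt_eq x ht h',
      valueAt_eq x (a := a * t + s * b) (s := s * t) (by simp [hs, ht])
        (by rw [map_add, map_mul, map_add, map_mul, map_mul, ← h, ← h']; ring)]
    rw [map_add, map_mul, map_mul, map_mul, div_add_div _ _ hs ht]
  commutes' c := by
    rw [valueAt_eq x (a := algebraMap k R c) (s := 1) (by simp)
      (by rw [AlgHom.commutes, map_one, mul_one, ← IsScalarTower.algebraMap_apply])]
    simp

open Classical in
/-- The rational map on `k`-points; a point outside the domain is (by convention) left fixed.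
It is only used along orbits that are defined. -/
noncomputable def step (φ : R →ₐ[k] FractionRing R) (x : R →ₐ[k] k) : R →ₐ[k] k :=
  if hx : toPrime x ∈ domain φ then image φ x hx else x

/-- The orbit of `x` is defined: `x`, `σ(x)`, `σ²(x)`, … all lie in the domain of `σ`. -/
def OrbitDefined (φ : R →ₐ[k] FractionRing R) (x : R →ₐ[k] k) : Prop :=
  ∀ i : ℕ, toPrime ((step φ)^[i] x) ∈ domain φ

/-- The times at which the orbit of `x` meets the subset `Y` of `X`. -/
def returnSet (φ : R →ₐ[k] FractionRing R) (x : R →ₐ[k] k) (Y : Set (PrimeSpectrum R)) : Set ℕ :=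
  {i : ℕ | toPrime ((step φ)^[i] x) ∈ Y}

end AffineRationalMap

/-- `S` is a finite union of arithmetic progressions `j + ℕ l` with `j, l ∈ ℕ`
(`l = 0`, a single point, is allowed). -/
def IsFiniteUnionOfAP (S : Set ℕ) : Prop :=
  ∃ P : Finset (ℕ × ℕ), S = ⋃ p ∈ P, {i : ℕ | ∃ m : ℕ, i = p.1 + m * p.2}

/-! ### The rational map `(b, B) ↦ (b + 1, A(b) B)` on `𝔸¹ × GLₙ` -/

namespace SkewMap

variable (k : Type*) [Field k] (n : ℕ)

/-- The generic matrix `Z` over `k[z]`. -/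
noncomputable abbrev genericMatrix : Matrix (Fin n) (Fin n) (MvPolynomial (Fin n × Fin n) k[X]) :=
  Matrix.mvPolynomialX (Fin n) (Fin n) k[X]

/-- The coordinate ring `k[z, Zᵢⱼ, 1/det Z]` of `X = 𝔸¹ × GLₙ`. -/
abbrev CoordRing : Type _ := Localization.Away (genericMatrix k n).det

theorem powers_det_le :
    Submonoid.powers (genericMatrix k n).det ≤
      nonZeroDivisors (MvPolynomial (Fin n × Fin n) k[X]) :=
  powers_le_nonZeroDivisors_of_noZeroDivisors (Matrix.det_mvPolynomialX_ne_zero (Fin n) k[X])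

instance : IsDomain (CoordRing k n) :=
  IsLocalization.isDomain_localization (powers_det_le k n)

/-- The function field `k(X)` of `X = 𝔸¹ × GLₙ`. -/
abbrev FunField : Type _ := FractionRing (CoordRing k n)

theorem algebraMap_injective : Function.Injective (algebraMap k[X] (FunField k n)) := by
  rw [IsScalarTower.algebraMap_eq k[X] (CoordRing k n) (FunField k n),
    IsScalarTower.algebraMap_eq k[X] (MvPolynomial (Fin n × Fin n) k[X]) (CoordRing k n)]
  exact (IsFractionRing.injective (CoordRing k n) (FunField k n)).comp
    ((IsLocalization.injective (CoordRing k n) (powers_det_le k n)).comp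
      (MvPolynomial.C_injective _ _))

/-- The inclusion `k(z) ⊆ k(X)`. -/
noncomputable def ratFuncHom : RatFunc k →ₐ[k] FunField k n :=
  RatFunc.liftAlgHom (IsScalarTower.toAlgHom k k[X] (FunField k n))
    (nonZeroDivisors_le_comap_nonZeroDivisors_of_injective _ (algebraMap_injective k n))

/-- The generic matrix `Z` over the function field `k(X)`. -/
noncomputable def genericMatrixFun : Matrix (Fin n) (Fin n) (FunField k n) :=
  (genericMatrix k n).map (algebraMap _ (FunField k n))

theorem isUnit_det_genericMatrixFun : IsUnit (genericMatrixFun k n).det := by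
  have h : (genericMatrixFun k n).det = algebraMap _ (FunField k n) (genericMatrix k n).det := by
    rw [RingHom.map_det]; rfl
  rw [h, IsScalarTower.algebraMap_apply _ (CoordRing k n) (FunField k n)]
  exact (IsLocalization.Away.algebraMap_isUnit (S := CoordRing k n) _).map _

variable {k n}

/-- The matrix `A Z` over the function field `k(X)`. -/
noncomputable def imageMatrix (A : GL (Fin n) (RatFunc k)) :
    Matrix (Fin n) (Fin n) (FunField k n) :=
  A.val.map (ratFuncHom k n) * genericMatrixFun k n

/-- The comorphism of `σ` on `k[z, Zᵢⱼ]`: `z ↦ z + 1`, `Z ↦ A Z`. -/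
noncomputable def comorphismAux (A : GL (Fin n) (RatFunc k)) :
    MvPolynomial (Fin n × Fin n) k[X] →+* FunField k n :=
  MvPolynomial.eval₂Hom
    (Polynomial.aeval (algebraMap k[X] (FunField k n) X + 1) : k[X] →ₐ[k] FunField k n).toRingHom
    (fun p => imageMatrix A p.1 p.2)

theorem comorphismAux_isUnit (A : GL (Fin n) (RatFunc k)) :
    IsUnit (comorphismAux A (genericMatrix k n).det) := by
  have h : comorphismAux A (genericMatrix k n).det = (imageMatrix A).det := by
    rw [RingHom.map_det]
    congr 1
    ext i j
    simp [comorphismAux, Matrix.mvPolynomialX]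
  have h' : (A.val.map (ratFuncHom k n)).det = ratFuncHom k n A.val.det :=
    (AlgHom.map_det (ratFuncHom k n) A.val).symm
  rw [h, imageMatrix, Matrix.det_mul, h']
  exact (((Matrix.isUnit_iff_isUnit_det _).mp A.isUnit).map _).mul
    (isUnit_det_genericMatrixFun k n)

/-- The rational map `σ : X ⇢ X`, `σ(b, B) = (b + 1, A(b) B)`, given by its comorphism
`k[z, Zᵢⱼ, 1/det Z] → k(X)`, `z ↦ z + 1`, `Z ↦ A Z`. -/
noncomputable def comorphism (A : GL (Fin n) (RatFunc k)) : CoordRing k n →ₐ[k] FunField k n :=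
  { IsLocalization.Away.lift (S := CoordRing k n) (genericMatrix k n).det
      (comorphismAux_isUnit A) with
    commutes' := fun c => by
      rw [IsScalarTower.algebraMap_apply k (MvPolynomial (Fin n × Fin n) k[X]) (CoordRing k n)]
      simp [comorphismAux, MvPolynomial.algebraMap_eq,
        IsScalarTower.algebraMap_apply k k[X] (MvPolynomial (Fin n × Fin n) k[X])] }

/-- The evaluation `k[z, Zᵢⱼ] → k` at `z = b`, `Z = B`. -/
noncomputable def pointAux (b : k) (B : GL (Fin n) k) :
    MvPolynomial (Fin n × Fin n) k[X] →+* k :=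
  MvPolynomial.eval₂Hom (Polynomial.evalRingHom b) (fun p => B.val p.1 p.2)

theorem pointAux_isUnit (b : k) (B : GL (Fin n) k) :
    IsUnit (pointAux b B (genericMatrix k n).det) := by
  have h : pointAux b B (genericMatrix k n).det = B.val.det := by
    rw [RingHom.map_det]
    congr 1
    ext i j
    simp [pointAux, Matrix.mvPolynomialX]
  rw [h]
  exact (Matrix.isUnit_iff_isUnit_det _).mp B.isUnit

/-- The `k`-point `(b, B)` of `X = 𝔸¹ × GLₙ`. -/
noncomputable def point (b : k) (B : GL (Fin n) k) : CoordRing k n →ₐ[k] k :=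
  { IsLocalization.Away.lift (S := CoordRing k n) (genericMatrix k n).det
      (pointAux_isUnit b B) with
    commutes' := fun c => by
      rw [IsScalarTower.algebraMap_apply k (MvPolynomial (Fin n × Fin n) k[X]) (CoordRing k n)]
      simp [pointAux, MvPolynomial.algebraMap_eq,
        IsScalarTower.algebraMap_apply k k[X] (MvPolynomial (Fin n × Fin n) k[X])] }

end SkewMap

/-! ### Picard–Vessiot extensions -/

/-- A difference ring `(L, σ)` is a `σ`-pseudo field if `L = e₀L ⊕ ⋯ ⊕ e_{l-1}L` for orthogonal
idempotents that `σ` permutes cyclically and such that each ring `eᵢL` is a field. -/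
def IsPseudoField (L : Type*) [CommRing L] (σ : L →+* L) : Prop :=
  ∃ (l : ℕ) (_ : NeZero l) (e : Fin l → L) (he : CompleteOrthogonalIdempotents e),
    (∀ i, σ (e i) = e (i + 1)) ∧ ∀ i, IsField (he.idem i).Corner

/-- `(L, σL)` is a Picard–Vessiot extension of the difference field `(K, σK)` for the system
`σ(y) = A y`. -/
structure IsPicardVessiotExtension {K L : Type*} [Field K] [CommRing L] [Algebra K L]
    (σK : K →+* K) (σL : L →+* L) {n : ℕ} (A : GL (Fin n) K) : Prop where
  map_algebraMap : ∀ c : K, σL (algebraMap K L c) = algebraMap K L (σK c)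
  isPseudoField : IsPseudoField L σL
  /-- `L` is the total ring of fractions of `K[Yᵢⱼ]` for a fundamental solution matrix `Y`. -/
  exists_fundamental : ∃ Y : GL (Fin n) L,
    Y.val.map σL = A.val.map (algebraMap K L) * Y.val ∧
    IsFractionRing (Algebra.adjoin K (Set.range fun p : Fin n × Fin n => Y.val p.1 p.2)) L
  constants : ∀ x : L, σL x = x → ∃ c : K, σK c = c ∧ algebraMap K L c = x

/-- The endomorphism `h(z) ↦ h(z + 1)` of `k(z)`. -/
noncomputable def ratFuncShift (k : Type*) [Field k] : RatFunc k →+* RatFunc k :=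
  RatFunc.mapRingHom (Polynomial.compRingHom (X + C 1 : k[X]))
    (nonZeroDivisors_le_comap_nonZeroDivisors_of_injective _ (by
      intro p q h
      have := congrArg (fun r : k[X] => r.comp (X - C 1)) h
      simpa [Polynomial.comp_assoc] using this))

/-! ### The ring of sequences -/

/-- The ring of sequences `ℕ → k`, where two sequences are identified if they agree at all large
enough arguments. -/
def SeqRing (k : Type*) : Type _ := Filter.Germ (Filter.atTop : Filter ℕ) k

namespace SeqRing

theorem exists_rep {k : Type*} (s : SeqRing k) :
    ∃ f : ℕ → k, (f : Filter.Germ (Filter.atTop : Filter ℕ) k) = s :=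
  Quotient.exists_rep s

variable {k : Type*} [Field k]

noncomputable instance : CommRing (SeqRing k) :=
  inferInstanceAs (CommRing (Filter.Germ (Filter.atTop : Filter ℕ) k))

/-- The class of a sequence. -/
def mk (f : ℕ → k) : SeqRing k := (f : Filter.Germ (Filter.atTop : Filter ℕ) k)

theorem mk_eq_mk {f g : ℕ → k} : mk f = mk g ↔ ∀ᶠ i in Filter.atTop, f i = g i :=
  Filter.Germ.coe_eq

/-- The left shift `(f(0), f(1), …) ↦ (f(1), f(2), …)`. -/
noncomputable def shift (k : Type*) [Field k] : SeqRing k →+* SeqRing k where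
  toFun s := Filter.Germ.compTendsto s (fun i : ℕ => i + 1) (Filter.tendsto_add_atTop_nat 1)
  map_one' := rfl
  map_zero' := rfl
  map_mul' s t := by
    obtain ⟨f, rfl⟩ := exists_rep s
    obtain ⟨g, rfl⟩ := exists_rep t
    rfl
  map_add' s t := by
    obtain ⟨f, rfl⟩ := exists_rep s
    obtain ⟨g, rfl⟩ := exists_rep t
    rfl

theorem shift_mk (f : ℕ → k) : shift k (mk f) = mk fun i => f (i + 1) := rfl

theorem eventually_eval_ne_zero [CharZero k] {p : k[X]} (hp : p ≠ 0) :
    ∀ᶠ i : ℕ in Filter.atTop, p.eval₂ (RingHom.id k) (i : k) ≠ 0 := by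
  rw [← Nat.cofinite_eq_atTop]
  have hfin : Set.Finite {i : ℕ | p.eval (i : k) = 0} := by
    refine Set.Finite.of_finite_image (f := fun i : ℕ => (i : k)) ?_
      (Nat.cast_injective.injOn)
    refine (Polynomial.finite_setOfPred_isRoot hp).subset ?_
    rintro _ ⟨i, hi, rfl⟩
    exact hi
  refine hfin.subset ?_
  intro i hi
  simpa [Polynomial.eval₂_id] using hi

/-- The embedding `h ↦ (h(0), h(1), h(2), …)` of `k(z)` into the ring of sequences; `h(i)` is
defined for all large enough `i`. -/
noncomputable def ofRatFunc (k : Type*) [Field k] [CharZero k] : RatFunc k →+* SeqRing k where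
  toFun h := mk fun i => RatFunc.eval (RingHom.id k) (i : k) h
  map_one' := by simp only [RatFunc.eval_one]; rfl
  map_zero' := by simp only [RatFunc.eval_zero]; rfl
  map_mul' x y := mk_eq_mk.mpr <| by
    filter_upwards [eventually_eval_ne_zero x.denom_ne_zero,
      eventually_eval_ne_zero y.denom_ne_zero] with i hx hy using RatFunc.eval_mul _ _ hx hy
  map_add' x y := mk_eq_mk.mpr <| by
    filter_upwards [eventually_eval_ne_zero x.denom_ne_zero,
      eventually_eval_ne_zero y.denom_ne_zero] with i hx hy using RatFunc.eval_add _ _ hx hy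

noncomputable instance [CharZero k] : Algebra (RatFunc k) (SeqRing k) := (ofRatFunc k).toAlgebra

end SeqRing

/-- There is a Picard–Vessiot extension of `k(z)` for `σ(y) = A y` inside the ring of sequences:
a `k(z)`-subalgebra of it, stable under the shift, which with the restricted shift is a
Picard–Vessiot extension. -/
def HasPicardVessiotInSeq {k : Type*} [Field k] [CharZero k] {n : ℕ}
    (A : GL (Fin n) (RatFunc k)) : Prop :=
  ∃ (L : Subalgebra (RatFunc k) (SeqRing k)) (hL : ∀ x ∈ L, SeqRing.shift k x ∈ L),
    IsPicardVessiotExtension (ratFuncShift k) ((SeqRing.shift k).restrict L L hL) A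

/-!
The values of the coordinate matrix along an orbit form a fundamental matrix of `σ(y) = A y` in
`Seq_k`, so both the return sets and the Picard–Vessiot extension are governed by the sequences
`s = (f(σⁱ(x)))ᵢ`. The zero set of a sequence `s` is eventually periodic exactly when `s` and some
shift `σˡ(s)` with `l > 0` divide each other. In a pseudo field every element is associate to an
idempotent fixed by a power of `σ`, whence statement 1. Conversely, if all elements of `k(z)[Yᵢⱼ]`
have eventually periodic zero set, then its non-zero-divisors are units of `Seq_k`, so its total
ring of fractions embeds into `Seq_k`. This is a reduced Noetherian ring whose non-zero-divisors are
units, hence a finite product of fields, and `σ` permutes the factors transitively because a shift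
invariant sequence is constant.
-/

/-! ### Eventually periodic sets of natural numbers -/

theorem isSemilinearSet_iff_eventually {S : Set ℕ} :
    IsSemilinearSet S ↔ ∃ l > 0, ∀ᶠ i in Filter.atTop, (i ∈ S ↔ i + l ∈ S) := by
  rw [Nat.isSemilinearSet_iff_ultimately_periodic, exists_comm]
  simp only [Filter.eventually_atTop, exists_and_left]

theorem isSemilinearSet_preimage_add_iff {S : Set ℕ} (b : ℕ) :
    IsSemilinearSet {i | i + b ∈ S} ↔ IsSemilinearSet S := by
  simp only [isSemilinearSet_iff_eventually]
  refine exists_congr fun l => and_congr_right fun _ => ?_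
  conv_rhs => rw [← Filter.map_add_atTop_eq_nat b, Filter.eventually_map]
  simp only [Set.mem_ofPred_eq, add_right_comm]

theorem isSemilinearSet_progression (j l : ℕ) :
    IsSemilinearSet {i : ℕ | ∃ m : ℕ, i = j + m * l} := by
  convert! (IsSemilinearSet.closure_finset {l}).vadd j
  ext i
  simp [Set.mem_vadd_set, AddSubmonoid.mem_closure_singleton, eq_comm]

theorem mem_iff_add_mul_mem_of_mem_iff_add_mem {S : Set ℕ} {N l : ℕ}
    (h : ∀ i ≥ N, i ∈ S ↔ i + l ∈ S) (m : ℕ) {i : ℕ} (hi : N ≤ i) :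
    i ∈ S ↔ i + m * l ∈ S := by
  induction m with
  | zero => simp
  | succ m ih => rw [ih, h (i + m * l) (by lia), add_mul, one_mul, add_assoc]

theorem isFiniteUnionOfAP_iff_isSemilinearSet {S : Set ℕ} :
    IsFiniteUnionOfAP S ↔ IsSemilinearSet S := by
  classical
  refine ⟨?_, fun hS => ?_⟩
  · rintro ⟨P, rfl⟩
    exact .biUnion_finset fun p _ => isSemilinearSet_progression p.1 p.2
  obtain ⟨N, l, hl, h⟩ := Nat.isSemilinearSet_iff_ultimately_periodic.mp hS
  refine ⟨((Finset.range (N + l)).filter (· ∈ S)).image fun j => (j, if j < N then 0 else l), ?_⟩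
  ext i
  simp only [Set.mem_iUnion, Finset.mem_image, Finset.mem_filter, Finset.mem_range, exists_prop,
    exists_exists_and_eq_and, Set.mem_ofPred_eq]
  refine ⟨fun hi => ?_, ?_⟩
  · rcases lt_or_ge i N with hiN | hiN
    · exact ⟨i, ⟨by lia, hi⟩, 0, by simp⟩
    · have hmod : (i - N) % l < l := Nat.mod_lt _ hl
      have hdecomp : i = N + (i - N) % l + (i - N) / l * l := by
        have := Nat.mod_add_div' (i - N) l
        lia
      refine ⟨N + (i - N) % l, ⟨by lia, ?_⟩, (i - N) / l, by simpa using hdecomp⟩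
      rwa [mem_iff_add_mul_mem_of_mem_iff_add_mem h ((i - N) / l) (by lia), ← hdecomp]
  · rintro ⟨j, ⟨-, hj⟩, m, rfl⟩
    split_ifs with hjN
    · simpa using hj
    · exact (mem_iff_add_mul_mem_of_mem_iff_add_mem h m (not_lt.mp hjN)).mp hj

/-- `x` is periodic up to multiplication by units: some iterate `σ^[l] x` with `0 < l` and `x`
divide each other. For a sequence under the shift this says that its zero set is eventually
periodic, and it makes sense in any difference ring `(R, σ)`. -/
def IsAssociatePeriodic {R : Type*} [CommRing R] (σ : R →+* R) (x : R) : Prop :=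
  ∃ l > 0, x ∣ σ^[l] x ∧ σ^[l] x ∣ x

namespace IsAssociatePeriodic

variable {R S : Type*} [CommRing R] [CommRing S] {σ : R →+* R} {τ : S →+* S} {x y : R}

theorem of_dvd_dvd (hx : IsAssociatePeriodic σ x) (hxy : x ∣ y) (hyx : y ∣ x) :
    IsAssociatePeriodic σ y := by
  obtain ⟨l, hl, h₁, h₂⟩ := hx
  rw [← RingHom.coe_pow] at h₁ h₂
  refine ⟨l, hl, ?_, ?_⟩ <;> rw [← RingHom.coe_pow]
  · exact hyx.trans (h₁.trans (_root_.map_dvd (σ ^ l) hxy))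
  · exact (_root_.map_dvd (σ ^ l) hyx).trans (h₂.trans hxy)

theorem of_iterate_eq {l : ℕ} (hl : 0 < l) (hx : σ^[l] x = x) : IsAssociatePeriodic σ x :=
  ⟨l, hl, hx.symm.dvd, hx.dvd⟩

theorem map (hx : IsAssociatePeriodic σ x) {f : R →+* S} (hf : Function.Semiconj f σ τ) :
    IsAssociatePeriodic τ (f x) := by
  obtain ⟨l, hl, h₁, h₂⟩ := hx
  refine ⟨l, hl, ?_⟩
  rw [← (hf.iterate_right l).eq]
  exact ⟨_root_.map_dvd f h₁, _root_.map_dvd f h₂⟩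

theorem iterate_eq_of_isIdempotentElem (hx : IsAssociatePeriodic σ x) (he : IsIdempotentElem x) :
    ∃ l > 0, σ^[l] x = x := by
  obtain ⟨l, hl, ⟨a, ha⟩, ⟨b, hb⟩⟩ := hx
  have hσ : σ^[l] x * σ^[l] x = σ^[l] x := by
    rw [← RingHom.coe_pow, ← map_mul, he]
  refine ⟨l, hl, ?_⟩
  calc σ^[l] x = σ^[l] x * x := by rw [ha]; linear_combination -a * he.eq
    _ = x := by nth_rewrite 2 3 [hb]; linear_combination b * hσ

end IsAssociatePeriodic

theorem prod_iterate_ne_zero {R : Type*} [CommRing R] [Nontrivial R] {σ : R →+* R}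
    (hσ : Function.Injective σ) {s : R} (hs : s ∈ nonZeroDivisors R) (l : ℕ) :
    ∏ i ∈ Finset.range l, σ^[i] s ≠ 0 := by
  induction l with
  | zero => simp
  | succ l ih =>
    rw [Finset.prod_range_succ', Function.iterate_zero_apply]
    simp only [Function.iterate_succ_apply', ← map_prod]
    exact fun h0 => (map_ne_zero_iff σ hσ).mpr ih
      ((mul_right_mem_nonZeroDivisors_eq_zero_iff hs).mp h0)

namespace SeqRing

theorem mk_surjective {k : Type*} : Function.Surjective (mk : (ℕ → k) → SeqRing k) := exists_rep

variable {k : Type*} [Field k]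

theorem mk_mul (f g : ℕ → k) : mk f * mk g = mk (f * g) := rfl

theorem mk_eq_zero {f : ℕ → k} : mk f = 0 ↔ ∀ᶠ i in Filter.atTop, f i = 0 := mk_eq_mk

theorem mk_dvd_mk {f g : ℕ → k} :
    mk f ∣ mk g ↔ ∀ᶠ i in Filter.atTop, f i = 0 → g i = 0 := by
  constructor
  · rintro ⟨h, hh⟩
    obtain ⟨h, rfl⟩ := mk_surjective h
    filter_upwards [mk_eq_mk.mp hh] with i hi h0
    simp [hi, h0]
  · intro h
    refine ⟨mk (g / f), mk_eq_mk.mpr ?_⟩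
    filter_upwards [h] with i hi
    exact (mul_div_cancel_of_imp' (hi ·)).symm

theorem isUnit_mk {f : ℕ → k} : IsUnit (mk f) ↔ ∀ᶠ i in Filter.atTop, f i ≠ 0 := by
  rw [isUnit_iff_dvd_one, show (1 : SeqRing k) = mk 1 from rfl, mk_dvd_mk]
  simp

instance : IsReduced (SeqRing k) :=
  (isReduced_iff_pow_one_lt 2 one_lt_two).mpr fun s hs => by
    obtain ⟨f, rfl⟩ := mk_surjective s
    exact mk_eq_zero.mpr ((mk_eq_zero.mp hs).mono fun i hi => pow_eq_zero_iff two_ne_zero |>.mp hi)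

instance : Nontrivial (SeqRing k) :=
  inferInstanceAs (Nontrivial (Filter.Germ (Filter.atTop : Filter ℕ) k))

theorem shift_injective : Function.Injective (shift k) := by
  refine (injective_iff_map_eq_zero _).mpr fun s hs => ?_
  obtain ⟨f, rfl⟩ := mk_surjective s
  rw [shift_mk, mk_eq_zero] at hs
  rwa [mk_eq_zero, ← Filter.map_add_atTop_eq_nat 1, Filter.eventually_map]

theorem iterate_shift_mk (f : ℕ → k) (l : ℕ) : (shift k)^[l] (mk f) = mk fun i => f (i + l) := by
  induction l with
  | zero => rfl
  | succ l ih =>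
    rw [Function.iterate_succ_apply', ih, shift_mk]
    simp only [add_right_comm, add_assoc]

theorem exists_const_of_shift_eq {s : SeqRing k} (h : shift k s = s) :
    ∃ c : k, s = mk fun _ => c := by
  obtain ⟨f, rfl⟩ := mk_surjective s
  rw [shift_mk, mk_eq_mk] at h
  obtain ⟨N, hN⟩ := Filter.eventually_atTop.mp h
  refine ⟨f N, mk_eq_mk.mpr (Filter.eventually_atTop.mpr ⟨N, fun i hi => ?_⟩)⟩
  induction i, hi using Nat.le_induction with
  | base => rfl
  | succ i hi ih => rw [hN i hi, ih]

theorem isUnit_of_dvd_shift {s : SeqRing k} (h : s ∣ shift k s) (hs : s ≠ 0) : IsUnit s := by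
  obtain ⟨f, rfl⟩ := mk_surjective s
  rw [shift_mk, mk_dvd_mk] at h
  obtain ⟨N, hN⟩ := Filter.eventually_atTop.mp h
  rw [isUnit_mk]
  refine Filter.eventually_atTop.mpr ⟨N, fun i hi h0 => hs ?_⟩
  refine mk_eq_zero.mpr (Filter.eventually_atTop.mpr ⟨i, fun j hj => ?_⟩)
  induction j, hj using Nat.le_induction with
  | base => exact h0
  | succ j hj ih => exact hN j (hi.trans hj) ih

theorem isAssociatePeriodic_mk_iff {f : ℕ → k} :
    IsAssociatePeriodic (shift k) (mk f) ↔ IsSemilinearSet {i | f i = 0} := by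
  simp only [isSemilinearSet_iff_eventually, IsAssociatePeriodic, iterate_shift_mk, mk_dvd_mk,
    ← Filter.eventually_and, ← iff_iff_implies_and_implies, Set.mem_ofPred_eq]

theorem isUnit_of_dvd_iterate_shift {s : SeqRing k} {l : ℕ}
    (hs : s ∣ (shift k)^[l] s) (hl : 0 < l)
    (hne : ∏ i ∈ Finset.range l, (shift k)^[i] s ≠ 0) : IsUnit s := by
  refine isUnit_of_dvd_unit (Finset.dvd_prod_of_mem (fun i => (shift k)^[i] s)
    (Finset.mem_range.mpr hl)) (isUnit_of_dvd_shift ?_ hne)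
  simp only [map_prod, ← Function.iterate_succ_apply']
  obtain ⟨l, rfl⟩ := Nat.exists_eq_succ_of_ne_zero hl.ne'
  rw [Finset.prod_range_succ', Finset.prod_range_succ _ l]
  exact mul_dvd_mul_left _ hs

theorem isUnit_map_of_isAssociatePeriodic {S : Type*} [CommRing S] {σ : S →+* S}
    {f : S →+* SeqRing k} (hf : Function.Injective f) (hσ : Function.Semiconj f σ (shift k))
    {s : S} (hs : s ∈ nonZeroDivisors S) (hper : IsAssociatePeriodic (shift k) (f s)) :
    IsUnit (f s) := by
  have := f.domain_nontrivial
  have hσ_inj : Function.Injective σ :=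
    .of_comp (f := f) (hσ.comp_eq ▸ shift_injective.comp hf)
  obtain ⟨l, hl, hdvd, -⟩ := hper
  refine isUnit_of_dvd_iterate_shift hdvd hl ?_
  simp only [← (hσ.iterate_right _).eq, ← map_prod]
  exact (map_ne_zero_iff f hf).mpr (prod_iterate_ne_zero hσ_inj hs l)

end SeqRing

/-! ### Pseudo fields -/

section Idempotent

variable {R : Type*} [CommRing R]

theorem isField_corner_iff {e : R} (he : IsIdempotentElem e) :
    IsField he.Corner ↔ e ≠ 0 ∧ ∀ x : R, e * x = 0 ∨ x ∣ e := by
  have mem (x : R) : e * x ∈ Subsemigroup.corner e := by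
    rw [Subsemigroup.mem_corner_iff he, mul_right_comm, ← mul_assoc, he.eq]
    exact ⟨rfl, rfl⟩
  have mul_val (a : he.Corner) : e * a.1 = a.1 := ((Subsemigroup.mem_corner_iff he).mp a.2).1
  constructor
  · intro h
    refine ⟨?_, fun x => or_iff_not_imp_left.mpr fun hx => ?_⟩
    · rintro rfl
      obtain ⟨a, b, hab⟩ := h.exists_pair_ne
      exact hab (Subtype.ext (by rw [← mul_val a, ← mul_val b, zero_mul, zero_mul]))
    · obtain ⟨y, hy⟩ := h.mul_inv_cancel (a := ⟨e * x, mem x⟩) fun h0 =>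
        hx (congrArg Subtype.val h0)
      have hy : e * x * y.1 = e := congrArg Subtype.val hy
      exact ⟨e * y.1, by linear_combination -hy⟩
  · rintro ⟨he0, h⟩
    refine ⟨⟨0, 1, fun h0 => he0 (congrArg Subtype.val h0).symm⟩, mul_comm, fun {a} ha => ?_⟩
    obtain ⟨y, hy⟩ := (h a.1).resolve_left fun h0 => ha (Subtype.ext ((mul_val a).symm.trans h0))
    refine ⟨⟨e * y, mem y⟩, Subtype.ext ?_⟩
    change a.1 * (e * y) = e
    linear_combination -e * hy + he.eq

/-- A nonzero idempotent that is minimal with respect to divisibility. -/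
structure IsPrimitiveIdempotent (e : R) : Prop where
  isIdempotentElem : IsIdempotentElem e
  ne_zero : e ≠ 0
  mul_eq_zero_or_eq : ∀ f : R, IsIdempotentElem f → e * f = 0 ∨ e * f = e

namespace IsPrimitiveIdempotent

variable {e f : R}

theorem mul_eq_zero_of_ne (he : IsPrimitiveIdempotent e) (hf : IsPrimitiveIdempotent f)
    (hef : e ≠ f) : e * f = 0 := by
  refine (he.mul_eq_zero_or_eq f hf.isIdempotentElem).resolve_right fun h₁ => ?_
  rcases hf.mul_eq_zero_or_eq e he.isIdempotentElem with h₂ | h₂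
  · exact he.ne_zero (by rw [← h₁, mul_comm, h₂])
  · exact hef (by rw [← h₁, mul_comm, h₂])

theorem exists_of_isSemisimpleRing (R : Type*) [CommRing R] [IsSemisimpleRing R] [Nontrivial R] :
    ∃ e : R, IsPrimitiveIdempotent e := by
  obtain ⟨I, hI⟩ := IsAtomic.exists_atom (Ideal R)
  obtain ⟨e, he, rfl⟩ := IsSemisimpleRing.ideal_eq_span_idempotent I
  refine ⟨e, he, fun h => hI.1 (by simp [h]), fun f hf => ?_⟩
  rcases hI.le_iff.mp (Ideal.span_singleton_le_span_singleton.mpr (dvd_mul_right e f)) with h | h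
  · exact Or.inl (Ideal.span_singleton_eq_bot.mp h)
  · obtain ⟨c, hc⟩ := Ideal.span_singleton_le_span_singleton.mp h.ge
    exact Or.inr (by linear_combination (f - 1) * hc + e * c * hf.eq)

theorem isField_corner [IsSemisimpleRing R] (he : IsPrimitiveIdempotent e) :
    IsField he.isIdempotentElem.Corner := by
  refine (isField_corner_iff _).mpr ⟨he.ne_zero, fun x => ?_⟩
  obtain ⟨f, hf, hspan⟩ := IsSemisimpleRing.ideal_eq_span_idempotent (Ideal.span {x})
  have hxf : x ∣ f := Ideal.span_singleton_le_span_singleton.mp hspan.ge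
  have hfx : f ∣ x := Ideal.span_singleton_le_span_singleton.mp hspan.le
  rcases he.mul_eq_zero_or_eq f hf with h | h
  · exact Or.inl (zero_dvd_iff.mp (h ▸ mul_dvd_mul_left e hfx))
  · exact Or.inr (hxf.trans (Dvd.intro_left e h))

theorem map {σ : R →+* R} (hσ : ∀ f : R, IsIdempotentElem f → ∃ l > 0, σ^[l] f = f)
    (he : IsPrimitiveIdempotent e) : IsPrimitiveIdempotent (σ e) := by
  refine ⟨he.isIdempotentElem.map σ, fun h0 => he.ne_zero ?_, fun f hf => ?_⟩
  · obtain ⟨_ | l, hl, h⟩ := hσ e he.isIdempotentElem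
    · exact absurd hl (lt_irrefl 0)
    · rw [← h, Function.iterate_succ_apply, h0, ← RingHom.coe_pow, map_zero]
  · obtain ⟨_ | l, hl, h⟩ := hσ f hf
    · exact absurd hl (lt_irrefl 0)
    · rw [Function.iterate_succ_apply'] at h
      rw [← h, ← map_mul]
      refine (he.mul_eq_zero_or_eq (σ^[l] f) ?_).imp (fun h => ?_) (congrArg σ ·)
      · rw [← RingHom.coe_pow]
        exact hf.map (σ ^ l)
      · rw [h, map_zero]

end IsPrimitiveIdempotent

theorem isSemisimpleRing_of_isFractionRing_self [IsReduced R] [IsNoetherianRing R]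
    [IsFractionRing R R] : IsSemisimpleRing R := by
  have : Ring.KrullDimLE 0 R := .mk₀ fun P hP => by
    obtain ⟨M, hM, hPM⟩ := P.exists_le_maximal hP.ne_top
    obtain ⟨-, x, hx⟩ := isAssociatedPrime_iff.mp
      (Ideal.IsMaximal.mem_associatedPrimes_of_isFractionRing R M)
    have mem_M (y : R) : y ∈ M ↔ y * x = 0 := by simp [hx, Submodule.mem_colon_singleton]
    have hxM : x ∉ M := fun h => hM.ne_top <| (Ideal.eq_top_iff_one M).mpr <| by
      have : x ^ 2 = 0 := sq x ▸ (mem_M x).mp h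
      rw [mem_M, one_mul, eq_zero_of_pow_eq_zero this]
    have hMP : M ≤ P := fun y hy =>
      (hP.mem_or_mem ((mem_M y).mp hy ▸ P.zero_mem)).resolve_right fun h => hxM (hPM h)
    exact hPM.antisymm hMP ▸ hM
  have := IsNoetherianRing.isArtinianRing_of_krullDimLE_zero (R := R)
  exact IsArtinianRing.isSemisimpleRing_of_isReduced R

end Idempotent

namespace IsPseudoField

variable {L : Type*} [CommRing L] {σ : L →+* L}

open Fin.NatCast in
theorem isAssociatePeriodic (h : IsPseudoField L σ) (x : L) : IsAssociatePeriodic σ x := by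
  classical
  obtain ⟨l, _, e, he, hσ, hfield⟩ := h
  have iterate_eq (m : ℕ) (i : Fin l) : σ^[m] (e i) = e (i + (m : Fin l)) := by
    induction m with
    | zero => simp
    | succ m ih => rw [Function.iterate_succ_apply', ih, hσ, Nat.cast_succ, add_assoc]
  let support : L := ∑ i with e i * x ≠ 0, e i
  have support_mul : support * x = x := by
    rw [Finset.sum_mul, Finset.sum_filter_ne_zero, ← Finset.sum_mul, he.complete, one_mul]
  have dvd_support : x ∣ support := Finset.dvd_sum fun i hi =>
    (((isField_corner_iff _).mp (hfield i)).2 x).resolve_left (Finset.mem_filter.mp hi).2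
  have iterate_support : σ^[l] support = support := by
    rw [← RingHom.coe_pow, map_sum]
    refine Finset.sum_congr rfl fun i _ => ?_
    rw [RingHom.coe_pow, iterate_eq, Fin.natCast_self, add_zero]
  exact (IsAssociatePeriodic.of_iterate_eq (NeZero.pos l) iterate_support).of_dvd_dvd
    (Dvd.intro x support_mul) dvd_support

theorem of_isSemisimpleRing [IsSemisimpleRing L] [Nontrivial L]
    (hper : ∀ e : L, IsIdempotentElem e → ∃ l > 0, σ^[l] e = e)
    (hfix : ∀ e : L, IsIdempotentElem e → σ e = e → e = 0 ∨ e = 1) : IsPseudoField L σ := by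
  obtain ⟨e, he⟩ := IsPrimitiveIdempotent.exists_of_isSemisimpleRing L
  have hprim (i : ℕ) : IsPrimitiveIdempotent (σ^[i] e) := by
    induction i with
    | zero => exact he
    | succ i ih => exact Function.iterate_succ_apply' σ i e ▸ ih.map hper
  let d := Function.minimalPeriod σ e
  obtain ⟨l, hl, hle⟩ := hper e he.isIdempotentElem
  have : NeZero d := ⟨(Function.IsPeriodicPt.minimalPeriod_pos hl hle).ne'⟩
  let orbit (i : Fin d) : L := σ^[i] e
  have map_orbit (i : Fin d) : σ (orbit i) = orbit (i + 1) := by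
    simp only [orbit, d, Fin.val_add, Fin.val_one', Nat.add_mod_mod,
      Function.iterate_mod_minimalPeriod_eq, Function.iterate_succ_apply']
  have horth : OrthogonalIdempotents orbit :=
    ⟨fun i => (hprim i).isIdempotentElem, fun i j hij =>
      (hprim i).mul_eq_zero_of_ne (hprim j) fun h => hij <| Fin.ext <|
        Function.iterate_injOn_Iio_minimalPeriod i.2 j.2 h⟩
  have hsum : ∑ i, orbit i = 1 := by
    refine (hfix _ horth.isIdempotentElem_sum ?_).resolve_left fun h0 => he.ne_zero ?_
    · simp only [map_sum, map_orbit]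
      exact Equiv.sum_comp (Equiv.addRight (1 : Fin d)) orbit
    · have orbit_zero : orbit 0 = e := rfl
      rw [← orbit_zero, ← horth.mul_sum_of_mem (Finset.mem_univ 0), h0, mul_zero]
  exact ⟨d, this, orbit, ⟨horth, hsum⟩, map_orbit, fun i => (hprim i).isField_corner⟩

end IsPseudoField

/-! ### Fundamental matrices and total rings of fractions -/

section FundamentalMatrix

open Matrix.GeneralLinearGroup (map)

variable {K R S : Type*} [CommRing K] [CommRing R] [CommRing S] [Algebra K R] [Algebra K S]
  {n : Type*} [Fintype n] [DecidableEq n]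

/-- `Y ∈ GLₙ(R)` is a fundamental solution matrix of the difference system `σ(y) = A y`. -/
def IsFundamentalMatrix (σ : R →+* R) (A : GL n K) (Y : GL n R) : Prop :=
  map σ Y = map (algebraMap K R) A * Y

/-- The `K`-algebra `K[Yᵢⱼ]` generated by the entries of `Y`. -/
def entryAlgebra (K : Type*) [CommRing K] [Algebra K R] (Y : GL n R) : Subalgebra K R :=
  Algebra.adjoin K (Set.range fun p : n × n => Y.val p.1 p.2)

theorem apply_mem_entryAlgebra (K : Type*) [CommRing K] [Algebra K R] (Y : GL n R) (i j : n) :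
    Y.val i j ∈ entryAlgebra K Y :=
  Algebra.subset_adjoin ⟨(i, j), rfl⟩

theorem entryAlgebra_fg (Y : GL n R) : (entryAlgebra K Y).FG :=
  Subalgebra.fg_def.mpr ⟨_, Set.finite_range _, rfl⟩

theorem map_entryAlgebra (f : R →ₐ[K] S) (Y : GL n R) :
    (entryAlgebra K Y).map f = entryAlgebra K (map (f : R →+* S) Y) := by
  rw [entryAlgebra, AlgHom.map_adjoin, ← Set.range_comp]
  rfl

namespace IsFundamentalMatrix

variable {σ : R →+* R} {τ : S →+* S} {A : GL n K} {Y W : GL n R}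

theorem map_inv_mul (hW : IsFundamentalMatrix σ A W) (hY : IsFundamentalMatrix σ A Y) :
    map σ (W⁻¹ * Y) = W⁻¹ * Y := by
  rw [map_mul, map_inv, hW, hY]
  group

theorem map_iff {f : R →ₐ[K] S} (hf : Function.Injective f) (hσ : Function.Semiconj f σ τ) :
    IsFundamentalMatrix τ A (map (f : R →+* S) Y) ↔ IsFundamentalMatrix σ A Y := by
  have map_injective : Function.Injective (map (n := n) (f : R →+* S)) :=
    Units.map_injective (Matrix.map_injective hf)
  have map_map : map τ (map (f : R →+* S) Y) = map (f : R →+* S) (map σ Y) :=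
    Units.ext (Matrix.ext fun i j => (hσ (Y.val i j)).symm)
  rw [IsFundamentalMatrix, map_map, ← f.comp_algebraMap, Matrix.GeneralLinearGroup.map_comp,
    MonoidHom.comp_apply, ← map_mul]
  exact map_injective.eq_iff

theorem map_mem_entryAlgebra {σK : K →+* K} (hY : IsFundamentalMatrix σ A Y)
    (hσ : ∀ c, σ (algebraMap K R c) = algebraMap K R (σK c)) {x : R}
    (hx : x ∈ entryAlgebra K Y) : σ x ∈ entryAlgebra K Y := by
  induction hx using Algebra.adjoin_induction with
  | mem x hx =>
    obtain ⟨⟨i, j⟩, rfl⟩ := hx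
    have hij : σ (Y.val i j) = ∑ m, algebraMap K R (A.val i m) * Y.val m j :=
      congrArg (fun M : GL n R => M.val i j) hY
    exact hij ▸ sum_mem fun m _ => mul_mem (algebraMap_mem _ _) (apply_mem_entryAlgebra K Y m j)
  | algebraMap c => exact hσ c ▸ algebraMap_mem _ _
  | add x y _ _ hx hy => exact map_add σ x y ▸ add_mem hx hy
  | mul x y _ _ hx hy => exact map_mul σ x y ▸ mul_mem hx hy

end IsFundamentalMatrix

theorem exists_generalLinearGroup_map_eq {f : R →+* S} [IsLocalHom f] {Y : GL n S}
    (hY : ∀ i j, Y.val i j ∈ f.range) : ∃ Z : GL n R, map f Z = Y := by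
  choose Z hZ using hY
  have map_Z : f.mapMatrix (Matrix.of Z) = Y.val := Matrix.ext hZ
  have hdet : IsUnit (Matrix.of Z).det := .of_map f _ <| by
    rw [f.map_det, map_Z]
    exact (Matrix.isUnit_iff_isUnit_det _).mp Y.isUnit
  exact ⟨.mk'' (Matrix.of Z) hdet, Units.ext map_Z⟩

end FundamentalMatrix

section FractionSubalgebra

variable {K R : Type*} [CommRing K] [CommRing R] [Algebra K R]

/-- The fractions of elements of `S` whose denominator is a unit of the ambient ring. -/
def fractionSubalgebra (S : Subalgebra K R) : Subalgebra K R where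
  carrier := {x | ∃ s ∈ S, IsUnit s ∧ x * s ∈ S}
  mul_mem' := by
    rintro x y ⟨s, hs, hsu, hx⟩ ⟨t, ht, htu, hy⟩
    exact ⟨s * t, mul_mem hs ht, hsu.mul htu, mul_mul_mul_comm x y s t ▸ mul_mem hx hy⟩
  add_mem' := by
    rintro x y ⟨s, hs, hsu, hx⟩ ⟨t, ht, htu, hy⟩
    refine ⟨s * t, mul_mem hs ht, hsu.mul htu, ?_⟩
    convert add_mem (mul_mem hx ht) (mul_mem hy hs) using 1
    ring
  algebraMap_mem' c :=
    ⟨1, one_mem S, isUnit_one, (mul_one (algebraMap K R c)).symm ▸ algebraMap_mem S c⟩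

variable {S : Subalgebra K R}

theorem le_fractionSubalgebra : S ≤ fractionSubalgebra S :=
  fun x hx => ⟨1, one_mem S, isUnit_one, (mul_one x).symm ▸ hx⟩

theorem map_mem_fractionSubalgebra {σ : R →+* R} (hσ : ∀ x ∈ S, σ x ∈ S) :
    ∀ x ∈ fractionSubalgebra S, σ x ∈ fractionSubalgebra S := by
  rintro x ⟨s, hs, hsu, hx⟩
  exact ⟨σ s, hσ s hs, hsu.map σ, map_mul σ x s ▸ hσ _ hx⟩

theorem isAssociatePeriodic_of_mem_fractionSubalgebra {σ : R →+* R}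
    (hS : ∀ x ∈ S, IsAssociatePeriodic σ x) :
    ∀ x ∈ fractionSubalgebra S, IsAssociatePeriodic σ x := by
  rintro x ⟨s, -, hs, hx⟩
  exact (hS _ hx).of_dvd_dvd (hs.mul_right_dvd.mpr dvd_rfl) (dvd_mul_right x s)

instance : IsLocalHom (fractionSubalgebra S).val := by
  constructor
  rintro ⟨x, s, hs, hsu, hx⟩ (hxu : IsUnit x)
  obtain ⟨y, hy⟩ := hxu.exists_right_inv
  refine IsUnit.of_mul_eq_one (a := _) ⟨y, x * s, hx, hxu.mul hsu, ?_⟩ (Subtype.ext hy)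
  rwa [mul_left_comm, ← mul_assoc, hy, one_mul]

theorem isFractionRing_fractionSubalgebra {T : Subalgebra K (fractionSubalgebra S)}
    (hT : T.map (fractionSubalgebra S).val = S)
    (hS : ∀ s : S, s ∈ nonZeroDivisors S → IsUnit (s : R)) :
    IsFractionRing T (fractionSubalgebra S) := by
  have mem_T (x : fractionSubalgebra S) : x ∈ T ↔ (x : R) ∈ S := by
    rw [← Subalgebra.comap_map_eq_self_of_injective
      (f := (fractionSubalgebra S).val) Subtype.val_injective T, hT]
    rfl
  refine ⟨?_, ?_, fun {x y} hxy => ⟨1, by rw [Subtype.ext hxy]⟩⟩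
  · rintro ⟨⟨⟨x, hxL⟩, hxT⟩, hx⟩
    have hxS : x ∈ S := (mem_T _).mp hxT
    refine .of_map (fractionSubalgebra S).val _ (hS ⟨x, hxS⟩ ?_)
    rw [mem_nonZeroDivisors_iff_right]
    rintro ⟨t, ht⟩ h0
    have := mem_nonZeroDivisors_iff_right.mp hx
      ⟨⟨t, le_fractionSubalgebra ht⟩, (mem_T _).mpr ht⟩
      (Subtype.ext (Subtype.ext (congrArg (fun y : S => (y : R)) h0)))
    exact Subtype.ext (congrArg (fun y : T => (y : R)) this)
  · rintro ⟨x, s, hs, hsu, hx⟩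
    refine ⟨(⟨⟨_, le_fractionSubalgebra hx⟩, (mem_T _).mpr hx⟩,
      ⟨⟨⟨s, le_fractionSubalgebra hs⟩, (mem_T _).mpr hs⟩, ?_⟩), rfl⟩
    rw [mem_nonZeroDivisors_iff_right]
    intro t h0
    have : (t : R) * s = 0 := congrArg (fun y : T => (y : R)) h0
    exact Subtype.ext (Subtype.ext (hsu.mul_left_eq_zero.mp this))

end FractionSubalgebra

namespace SeqRing

variable {k : Type*} [Field k]

theorem isPseudoField {L : Type*} [CommRing L] [IsNoetherianRing L] {σ : L →+* L}
    {f : L →+* SeqRing k} (hf : Function.Injective f) (hσ : Function.Semiconj f σ (shift k))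
    [IsLocalHom f] (hper : ∀ x, IsAssociatePeriodic (shift k) (f x)) : IsPseudoField L σ := by
  have := f.domain_nontrivial
  have := isReduced_of_injective f hf
  have : IsFractionRing L L := IsFractionRing.self_iff_nonZeroDivisors_le_isUnit.mpr
    fun x hx => .of_map f x (isUnit_map_of_isAssociatePeriodic hf hσ hx (hper x))
  have := isSemisimpleRing_of_isFractionRing_self (R := L)
  refine .of_isSemisimpleRing (fun e he => ?_) fun e he hσe => or_iff_not_imp_left.mpr fun he0 => ?_
  · obtain ⟨l, hl, h⟩ := (hper e).iterate_eq_of_isIdempotentElem (he.map f)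
    exact ⟨l, hl, hf ((hσ.iterate_right l e).trans h)⟩
  · have hfe : f e ∣ shift k (f e) := by rw [← hσ, hσe]
    exact (IsIdempotentElem.iff_eq_one_of_isUnit
      (.of_map f e (isUnit_of_dvd_shift hfe ((map_ne_zero_iff f hf).mpr he0)))).mp he

variable [CharZero k]

theorem algebraMap_polynomial (p : k[X]) :
    algebraMap (RatFunc k) (SeqRing k) (algebraMap k[X] (RatFunc k) p) =
      mk fun i : ℕ => p.eval (i : k) := by
  change mk (fun i : ℕ => RatFunc.eval (RingHom.id k) (i : k) _) = _
  simp only [RatFunc.eval_algebraMap, Polynomial.eval₂_id, Algebra.algebraMap_self_apply]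

theorem algebraMap_C (c : k) :
    algebraMap (RatFunc k) (SeqRing k) (RatFunc.C c) = mk fun _ => c := by
  rw [← RatFunc.algebraMap_C, algebraMap_polynomial]
  simp only [Polynomial.eval_C]

theorem ratFuncShift_algebraMap (p : k[X]) : ratFuncShift k (algebraMap k[X] (RatFunc k) p) =
    algebraMap k[X] (RatFunc k) (p.comp (X + C 1)) := by
  have hinj : Function.Injective (compRingHom (X + C 1 : k[X])) :=
    (injective_iff_map_eq_zero _).mpr fun _ => comp_X_add_C_eq_zero_iff.mp
  have h := RatFunc.map_apply_div_ne_zero _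
    (nonZeroDivisors_le_comap_nonZeroDivisors_of_injective _ hinj) p 1 one_ne_zero
  simpa [ratFuncShift, RatFunc.coe_mapRingHom_eq_coe_map] using h

theorem shift_algebraMap (h : RatFunc k) : shift k (algebraMap (RatFunc k) (SeqRing k) h) =
    algebraMap (RatFunc k) (SeqRing k) (ratFuncShift k h) := by
  have : (shift k).comp (algebraMap (RatFunc k) (SeqRing k)) =
      (algebraMap (RatFunc k) (SeqRing k)).comp (ratFuncShift k) := by
    refine IsLocalization.ringHom_ext (nonZeroDivisors k[X]) (RingHom.ext fun p => ?_)
    simp [ratFuncShift_algebraMap, algebraMap_polynomial, shift_mk]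
  exact RingHom.congr_fun this h

end SeqRing

section PicardVessiot

variable {k : Type*} [Field k] [CharZero k] {n : ℕ} {A : GL (Fin n) (RatFunc k)}
  {Y : GL (Fin n) (SeqRing k)}

open SeqRing
open Matrix.GeneralLinearGroup (map)

theorem HasPicardVessiotInSeq.of_isFundamentalMatrix (hY : IsFundamentalMatrix (shift k) A Y)
    (hper : ∀ s ∈ entryAlgebra (RatFunc k) Y, IsAssociatePeriodic (shift k) s) :
    HasPicardVessiotInSeq A := by
  let S := entryAlgebra (RatFunc k) Y
  let L := fractionSubalgebra S
  have hL : ∀ x ∈ L, shift k x ∈ L :=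
    map_mem_fractionSubalgebra fun x => hY.map_mem_entryAlgebra shift_algebraMap
  let σ : L →+* L := (shift k).restrict L L hL
  have hσ : Function.Semiconj L.val σ (shift k) := fun _ => rfl
  have val_injective : Function.Injective L.val := Subtype.val_injective
  obtain ⟨Z, hZ⟩ := exists_generalLinearGroup_map_eq (f := (L.val : L →+* SeqRing k)) (Y := Y)
    fun i j => ⟨⟨_, le_fractionSubalgebra (apply_mem_entryAlgebra (RatFunc k) Y i j)⟩, rfl⟩
  let T := entryAlgebra (RatFunc k) Z
  have hT : T.map L.val = S := by rw [map_entryAlgebra, hZ]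
  have isUnit_of_mem : ∀ s : S, s ∈ nonZeroDivisors S → IsUnit (s : SeqRing k) := fun s hs =>
    isUnit_map_of_isAssociatePeriodic (f := (S.val : S →+* SeqRing k))
      (σ := (shift k).restrict S S fun _ => hY.map_mem_entryAlgebra shift_algebraMap)
      Subtype.val_injective (fun _ => rfl) hs (hper s s.2)
  have hfrac : IsFractionRing T L := isFractionRing_fractionSubalgebra hT isUnit_of_mem
  have : IsNoetherianRing L := IsLocalization.isNoetherianRing (nonZeroDivisors T) L
    (isNoetherianRing_of_fg (entryAlgebra_fg Z))
  have hperL (x : L) : IsAssociatePeriodic (shift k) (x : SeqRing k) :=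
    isAssociatePeriodic_of_mem_fractionSubalgebra hper x x.2
  refine ⟨L, hL, fun c => Subtype.ext (shift_algebraMap c),
    isPseudoField (f := (L.val : L →+* SeqRing k)) val_injective hσ hperL,
    ⟨Z, congrArg Units.val ((IsFundamentalMatrix.map_iff val_injective hσ).mp (hZ ▸ hY)), hfrac⟩,
    fun x hx => ?_⟩
  obtain ⟨c, hc⟩ := exists_const_of_shift_eq (congrArg Subtype.val hx)
  refine ⟨RatFunc.C c, ?_, Subtype.ext ((algebraMap_C c).trans hc.symm)⟩
  rw [← RatFunc.algebraMap_C, ratFuncShift_algebraMap, Polynomial.C_comp]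

theorem exists_map_algebraMap_eq_of_map_shift_eq (hY : map (shift k) Y = Y) :
    ∃ C : GL (Fin n) (RatFunc k), map (algebraMap (RatFunc k) (SeqRing k)) C = Y := by
  refine exists_generalLinearGroup_map_eq fun i j => ?_
  obtain ⟨c, hc⟩ := exists_const_of_shift_eq (congrArg (fun M => M.val i j) hY)
  exact ⟨RatFunc.C c, (algebraMap_C c).trans hc.symm⟩

/-- Two fundamental matrices differ by a constant matrix, so every fundamental matrix in the ring of
sequences already has entries in any given Picard–Vessiot extension. -/
theorem HasPicardVessiotInSeq.exists_subalgebra (h : HasPicardVessiotInSeq A)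
    (hY : IsFundamentalMatrix (shift k) A Y) :
    ∃ L : Subalgebra (RatFunc k) (SeqRing k),
      (∃ Z : GL (Fin n) L, map (L.val : L →+* SeqRing k) Z = Y) ∧
        ∀ x ∈ L, IsAssociatePeriodic (shift k) x := by
  obtain ⟨L, hL, hPV⟩ := h
  let σ : L →+* L := (shift k).restrict L L hL
  have hσ : Function.Semiconj L.val σ (shift k) := fun _ => rfl
  obtain ⟨W, hW, -⟩ := hPV.exists_fundamental
  have isFundamentalMatrix_W : IsFundamentalMatrix σ A W := Units.ext hW
  have hW' := (IsFundamentalMatrix.map_iff Subtype.val_injective hσ).mpr isFundamentalMatrix_W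
  obtain ⟨C, hC⟩ := exists_map_algebraMap_eq_of_map_shift_eq (hW'.map_inv_mul hY)
  refine ⟨L, ⟨W * map (algebraMap (RatFunc k) L) C, ?_⟩, fun x hx => ?_⟩
  · have map_map : map (L.val : L →+* SeqRing k) (map (algebraMap (RatFunc k) L) C) =
        map (algebraMap (RatFunc k) (SeqRing k)) C := rfl
    rw [map_mul, map_map, hC, mul_inv_cancel_left]
  · exact (hPV.isPseudoField.isAssociatePeriodic ⟨x, hx⟩).map (f := L.val.toRingHom) hσ

end PicardVessiot

/-! ### Orbits of rational maps -/

namespace AffineRationalMap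

variable {k R : Type*} [Field k] [CommRing R] [Algebra k R] {φ : R →ₐ[k] FractionRing R}

theorem toPrime_mem_domain {s : R} (hs : IsDefinedOnBasicOpen φ s) {x : R →ₐ[k] k}
    (hx : x s ≠ 0) : toPrime x ∈ domain φ :=
  TopologicalSpace.Opens.mem_iSup.mpr ⟨⟨s, hs⟩, hx⟩

theorem isDefinedOnBasicOpen_iff [IsDomain R] {s : R} (hs : s ≠ 0) :
    IsDefinedOnBasicOpen φ s ↔ ∀ f, φ f ∈ Localization.subalgebra.ofField (FractionRing R)
      (.powers s) (powers_le_nonZeroDivisors_of_noZeroDivisors hs) := by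
  refine forall_congr' fun f => ?_
  have pow_ne_zero (m : ℕ) : algebraMap R (FractionRing R) (s ^ m) ≠ 0 :=
    (map_ne_zero_iff _ (IsFractionRing.injective R (FractionRing R))).mpr (pow_ne_zero m hs)
  constructor
  · rintro ⟨a, m, h⟩
    exact ⟨a, s ^ m, ⟨m, rfl⟩, (eq_mul_inv_iff_mul_eq₀ (pow_ne_zero m)).mpr h⟩
  · rintro ⟨a, _, ⟨m, rfl⟩, h⟩
    exact ⟨a, m, (eq_mul_inv_iff_mul_eq₀ (pow_ne_zero m)).mp h⟩

theorem step_mul_eq {x : R →ₐ[k] k} (hx : toPrime x ∈ domain φ) {f s a : R}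
    (h : φ f * algebraMap R (FractionRing R) s = algebraMap R (FractionRing R) a) :
    step φ x f * x s = x a := by
  obtain ⟨b, t, ht, h'⟩ := exists_fraction hx f
  have step_apply : step φ x f = x b / x t := by
    rw [step, dif_pos hx]
    exact valueAt_eq x ht h'
  have hbs : b * s = a * t := by
    apply IsFractionRing.injective R (FractionRing R)
    rw [map_mul, map_mul, ← h, ← h', mul_right_comm]
  rw [step_apply, div_mul_eq_mul_div, div_eq_iff ht, ← map_mul, ← map_mul, hbs]

/-- The sequence of values of a regular function along the orbit of `x`, delayed by `b`: the value
at `σⁱ(x)` has index `i + b`. For a point of `𝔸¹ × GLₙ` over `b ∈ ℕ` the index is thus the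
coordinate `z`. The finitely many entries before index `b` are irrelevant in the ring of
sequences. -/
noncomputable def orbitSeq (φ : R →ₐ[k] FractionRing R) (x : R →ₐ[k] k) (b : ℕ) :
    R →+* SeqRing k where
  toFun f := SeqRing.mk fun m => (step φ)^[m - b] x f
  map_one' := by simp only [map_one]; rfl
  map_zero' := by simp only [map_zero]; rfl
  map_mul' f g := by simp only [map_mul]; rfl
  map_add' f g := by simp only [map_add]; rfl

theorem orbitSeq_apply (x : R →ₐ[k] k) (b : ℕ) (f : R) :
    orbitSeq φ x b f = SeqRing.mk fun m => (step φ)^[m - b] x f := rfl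

theorem shift_orbitSeq_mul_eq {x : R →ₐ[k] k} (hx : OrbitDefined φ x) (b : ℕ) {f s a : R}
    (h : φ f * algebraMap R (FractionRing R) s = algebraMap R (FractionRing R) a) :
    SeqRing.shift k (orbitSeq φ x b f) * orbitSeq φ x b s = orbitSeq φ x b a := by
  simp only [orbitSeq_apply, SeqRing.shift_mk, SeqRing.mk_mul, SeqRing.mk_eq_mk]
  filter_upwards [Filter.eventually_ge_atTop b] with m hm
  rw [Pi.mul_apply, Nat.sub_add_comm hm, Function.iterate_succ_apply']
  exact step_mul_eq (hx (m - b)) h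

theorem returnSet_zeroLocus_span (x : R →ₐ[k] k) (F : Finset R) :
    returnSet φ x (PrimeSpectrum.zeroLocus (Ideal.span (F : Set R))) =
      ⋂ f ∈ F, {i | (step φ)^[i] x f = 0} := by
  rw [PrimeSpectrum.zeroLocus_span]
  ext i
  simp only [Set.mem_iInter]
  rfl

theorem isAssociatePeriodic_orbitSeq_iff (x : R →ₐ[k] k) (b : ℕ) (f : R) :
    IsAssociatePeriodic (SeqRing.shift k) (orbitSeq φ x b f) ↔
      IsSemilinearSet {i | (step φ)^[i] x f = 0} := by
  rw [orbitSeq_apply, SeqRing.isAssociatePeriodic_mk_iff, ← isSemilinearSet_preimage_add_iff b]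
  simp only [Set.mem_ofPred_eq, Nat.add_sub_cancel]

theorem forall_isFiniteUnionOfAP_returnSet_iff [IsNoetherianRing R] (x : R →ₐ[k] k) (b : ℕ) :
    (∀ Y : Set (PrimeSpectrum R), IsClosed Y → IsFiniteUnionOfAP (returnSet φ x Y)) ↔
      ∀ f, IsAssociatePeriodic (SeqRing.shift k) (orbitSeq φ x b f) := by
  simp only [isFiniteUnionOfAP_iff_isSemilinearSet, isAssociatePeriodic_orbitSeq_iff]
  constructor
  · intro h f
    have := h _ (PrimeSpectrum.isClosed_zeroLocus (Ideal.span (({f} : Finset R) : Set R)))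
    simpa only [returnSet_zeroLocus_span, Finset.mem_singleton, Set.iInter_iInter_eq_left]
  · intro h Y hY
    obtain ⟨I, rfl⟩ := (PrimeSpectrum.isClosed_iff_zeroLocus_ideal Y).mp hY
    obtain ⟨F, rfl⟩ := IsNoetherian.noetherian I
    rw [returnSet_zeroLocus_span]
    exact .biInter_finset fun f _ => h f

end AffineRationalMap

/-! ### The skew map on `𝔸¹ × GLₙ` -/

theorem det_mem_of_mem_matrix {R n : Type*} [CommRing R] [Fintype n] [DecidableEq n]
    {T : Subring R} {M : Matrix n n R} (hM : M ∈ T.matrix) : M.det ∈ T := by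
  rw [Matrix.det_apply]
  exact T.sum_mem fun σ _ => T.zsmul_mem (T.prod_mem fun i _ => hM _ _) _

namespace SkewMap

open AffineRationalMap SeqRing
open Matrix.GeneralLinearGroup (map)

variable {k : Type*} [Field k] {n : ℕ}

theorem algebraMap_coordRing_injective : Function.Injective (algebraMap k[X] (CoordRing k n)) :=
  .of_comp (f := algebraMap (CoordRing k n) (FunField k n)) <| by
    rw [← RingHom.coe_comp, ← IsScalarTower.algebraMap_eq]
    exact algebraMap_injective k n

variable (k n) in
/-- The generic matrix `Z` as an element of `GLₙ` of the coordinate ring. -/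
noncomputable def genericGL : GL (Fin n) (CoordRing k n) :=
  .mk'' ((genericMatrix k n).map (algebraMap _ (CoordRing k n))) <| by
    have map_det : ((genericMatrix k n).map (algebraMap _ (CoordRing k n))).det =
        algebraMap _ (CoordRing k n) (genericMatrix k n).det := (RingHom.map_det _ _).symm
    exact map_det ▸ IsLocalization.Away.algebraMap_isUnit (S := CoordRing k n) _

theorem apply_mem_of_map_genericGL_mem {S : Type*} [CommRing S] {f : CoordRing k n →+* S}
    {T : Subring S} (hpoly : ∀ p : k[X], f (algebraMap k[X] (CoordRing k n) p) ∈ T)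
    (hf : map f (genericGL k n) ∈ T.matrix.toSubmonoid.units) (g : CoordRing k n) : f g ∈ T := by
  obtain ⟨m, p, hp⟩ := IsLocalization.Away.surj (genericMatrix k n).det g
  have map_det : algebraMap _ (CoordRing k n) (genericMatrix k n).det = (genericGL k n).val.det :=
    RingHom.map_det _ _
  have f_det : f (genericGL k n).val.det = (map f (genericGL k n)).val.det := RingHom.map_det _ _
  have det_mul : (map f (genericGL k n)).val.det * (map f (genericGL k n))⁻¹.val.det = 1 := by
    rw [← Matrix.det_mul, ← Units.val_mul, mul_inv_cancel, Units.val_one, Matrix.det_one]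
  have f_numerator : f (algebraMap _ (CoordRing k n) p) ∈ T := by
    clear hp
    induction p using MvPolynomial.induction_on with
    | C p => exact hpoly p
    | add p q hp hq => rw [map_add, map_add]; exact T.add_mem hp hq
    | mul_X p ij hp => rw [map_mul, map_mul]; exact T.mul_mem hp (hf.1 ij.1 ij.2)
  have f_eq : f g = f (algebraMap _ (CoordRing k n) p) *
      (map f (genericGL k n))⁻¹.val.det ^ m := by
    rw [← hp, map_det, map_mul, map_pow, f_det, mul_assoc, ← mul_pow, det_mul, one_pow, mul_one]
  exact f_eq ▸ T.mul_mem f_numerator (T.pow_mem (det_mem_of_mem_matrix hf.2) m)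

/-- The coordinate `z(x)` of a point `x`. -/
noncomputable def baseCoord (x : CoordRing k n →ₐ[k] k) : k := x (algebraMap k[X] (CoordRing k n) X)

theorem apply_algebraMap (x : CoordRing k n →ₐ[k] k) (p : k[X]) :
    x (algebraMap k[X] (CoordRing k n) p) = p.eval (baseCoord x) := by
  have : x.comp (IsScalarTower.toAlgHom k k[X] (CoordRing k n)) = aeval (baseCoord x) :=
    Polynomial.algHom_ext (by simp [baseCoord])
  rw [← coe_aeval_eq_eval]
  exact DFunLike.congr_fun this p

theorem baseCoord_point (b : k) (B : GL (Fin n) k) : baseCoord (point b B) = b := by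
  have point_X : point b B (algebraMap k[X] (CoordRing k n) X) = pointAux b B (MvPolynomial.C X) :=
    IsLocalization.Away.lift_eq (genericMatrix k n).det (pointAux_isUnit b B) _
  rw [baseCoord, point_X]
  simp [pointAux]

theorem comorphism_algebraMap (A : GL (Fin n) (RatFunc k)) (p : k[X]) :
    comorphism A (algebraMap k[X] (CoordRing k n) p) =
      algebraMap (CoordRing k n) (FunField k n) (algebraMap k[X] _ (p.comp (X + 1))) := by
  have comorphism_p : comorphism A (algebraMap k[X] (CoordRing k n) p) =
      comorphismAux A (MvPolynomial.C p) :=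
    IsLocalization.Away.lift_eq (genericMatrix k n).det (comorphismAux_isUnit A) _
  rw [comorphism_p, ← IsScalarTower.algebraMap_apply, comp_eq_aeval]
  simp [comorphismAux, ← aeval_algebraMap_apply]

theorem map_comorphism_genericGL (A : GL (Fin n) (RatFunc k)) :
    map (comorphism A : CoordRing k n →+* FunField k n) (genericGL k n) =
      map (ratFuncHom k n : RatFunc k →+* FunField k n) A *
        map (algebraMap (CoordRing k n) (FunField k n)) (genericGL k n) := by
  have comorphism_Z (i j) : comorphism A ((genericGL k n).val i j) = imageMatrix A i j := by
    refine (IsLocalization.Away.lift_eq (genericMatrix k n).det (comorphismAux_isUnit A) _).trans ?_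
    simp [comorphismAux]
  refine Units.ext (Matrix.ext fun i j => (comorphism_Z i j).trans ?_)
  congr 2

theorem ratFuncHom_algebraMap (p : k[X]) : ratFuncHom k n (algebraMap k[X] (RatFunc k) p) =
    algebraMap (CoordRing k n) (FunField k n) (algebraMap k[X] (CoordRing k n) p) := by
  have := RatFunc.liftAlgHom_apply_div (φ := IsScalarTower.toAlgHom k k[X] (FunField k n))
    (nonZeroDivisors_le_comap_nonZeroDivisors_of_injective _ (algebraMap_injective k n)) p 1
  rw [← IsScalarTower.algebraMap_apply]
  simpa [ratFuncHom] using this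

variable {A : GL (Fin n) (RatFunc k)} {q : k[X]}

instance : IsNoetherianRing (CoordRing k n) :=
  IsLocalization.isNoetherianRing (.powers (genericMatrix k n).det) _ inferInstance

theorem exists_common_denominator (A : GL (Fin n) (RatFunc k)) :
    ∃ q : k[X], q ≠ 0 ∧ (∀ i j, IsLocalization.IsInteger k[X] (q • A.val i j)) ∧
      ∀ i j, IsLocalization.IsInteger k[X] (q • A⁻¹.val i j) := by
  obtain ⟨q, hq⟩ := IsLocalization.exist_integer_multiples_of_finite (nonZeroDivisors k[X])
    (Sum.elim (fun p : Fin n × Fin n => A.val p.1 p.2) fun p : Fin n × Fin n => A⁻¹.val p.1 p.2)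
  exact ⟨q, nonZeroDivisors.ne_zero q.2, fun i j => hq (.inl (i, j)), fun i j => hq (.inr (i, j))⟩

theorem ratFuncHom_mul_algebraMap {h : RatFunc k} {p : k[X]}
    (hp : algebraMap k[X] (RatFunc k) p = q • h) :
    ratFuncHom k n h * algebraMap (CoordRing k n) (FunField k n) (algebraMap k[X] _ q) =
      algebraMap (CoordRing k n) (FunField k n) (algebraMap k[X] _ p) := by
  rw [← ratFuncHom_algebraMap, ← ratFuncHom_algebraMap, hp, Algebra.smul_def, map_mul, mul_comm]

theorem comorphism_genericGL_mul_algebraMap {P : Fin n → k[X]} {i : Fin n}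
    (hP : ∀ l, algebraMap k[X] (RatFunc k) (P l) = q • A.val i l) (j : Fin n) :
    comorphism A ((genericGL k n).val i j) *
        algebraMap (CoordRing k n) (FunField k n) (algebraMap k[X] _ q) =
      algebraMap (CoordRing k n) (FunField k n)
        (∑ l, algebraMap k[X] _ (P l) * (genericGL k n).val l j) := by
  have comorphism_Z : comorphism A ((genericGL k n).val i j) = ∑ l, ratFuncHom k n (A.val i l) *
      algebraMap _ (FunField k n) ((genericGL k n).val l j) :=
    congrArg (fun M => M.val i j) (map_comorphism_genericGL A)
  rw [comorphism_Z, Finset.sum_mul, map_sum]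
  refine Finset.sum_congr rfl fun l _ => ?_
  rw [map_mul, ← ratFuncHom_mul_algebraMap (hP l), mul_right_comm]

theorem isDefinedOnBasicOpen_comorphism (hq : q ≠ 0)
    (hA : ∀ i j, IsLocalization.IsInteger k[X] (q • A.val i j))
    (hA' : ∀ i j, IsLocalization.IsInteger k[X] (q • A⁻¹.val i j)) :
    IsDefinedOnBasicOpen (comorphism A) (algebraMap k[X] (CoordRing k n) q) := by
  have hq' : algebraMap k[X] (CoordRing k n) q ≠ 0 :=
    (map_ne_zero_iff _ algebraMap_coordRing_injective).mpr hq
  rw [isDefinedOnBasicOpen_iff hq']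
  set T := Localization.subalgebra.ofField (FunField k n)
    (.powers (algebraMap k[X] (CoordRing k n) q)) (powers_le_nonZeroDivisors_of_noZeroDivisors hq')
  have ratFuncHom_mem {h : RatFunc k} (hh : IsLocalization.IsInteger k[X] (q • h)) :
      ratFuncHom k n h ∈ T := by
    obtain ⟨p, hp⟩ := hh
    refine ⟨algebraMap k[X] _ p, _, ⟨1, pow_one _⟩, (eq_mul_inv_iff_mul_eq₀ ?_).mpr
      (ratFuncHom_mul_algebraMap hp)⟩
    exact (map_ne_zero_iff _ (IsFractionRing.injective _ _)).mpr hq'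
  refine apply_mem_of_map_genericGL_mem (f := (comorphism A : CoordRing k n →+* FunField k n))
    (T := T.toSubring) (fun p => ?_) ?_
  · exact (comorphism_algebraMap A p).symm ▸ T.algebraMap_mem _
  · rw [map_comorphism_genericGL]
    exact mul_mem ⟨fun i j => ratFuncHom_mem (hA i j), fun i j => ratFuncHom_mem (hA' i j)⟩
      ⟨fun i j => T.algebraMap_mem _, fun i j => T.algebraMap_mem _⟩

theorem baseCoord_step {x : CoordRing k n →ₐ[k] k} (hx : toPrime x ∈ domain (comorphism A)) :
    baseCoord (step (comorphism A) x) = baseCoord x + 1 := by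
  have comorphism_X : comorphism A (algebraMap k[X] (CoordRing k n) X) *
      algebraMap (CoordRing k n) (FunField k n) 1 =
      algebraMap (CoordRing k n) (FunField k n) (algebraMap k[X] _ (X + 1)) := by
    rw [map_one, mul_one, comorphism_algebraMap, X_comp]
  have h := step_mul_eq hx comorphism_X
  simpa only [map_one, mul_one, apply_algebraMap, eval_add, eval_X, eval_one] using h

theorem baseCoord_iterate_step {x : CoordRing k n →ₐ[k] k} {i : ℕ}
    (hx : ∀ j < i, toPrime ((step (comorphism A))^[j] x) ∈ domain (comorphism A)) :
    baseCoord ((step (comorphism A))^[i] x) = baseCoord x + i := by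
  induction i with
  | zero => simp
  | succ i ih =>
    rw [Function.iterate_succ_apply', baseCoord_step (hx i i.lt_succ_self),
      ih fun j hj => hx j (hj.trans i.lt_succ_self), Nat.cast_succ, add_assoc]

theorem orbitDefined_of_eval_ne_zero
    (hq : IsDefinedOnBasicOpen (comorphism A) (algebraMap k[X] (CoordRing k n) q))
    {x : CoordRing k n →ₐ[k] k} (hx : ∀ i : ℕ, q.eval (baseCoord x + i) ≠ 0) :
    OrbitDefined (comorphism A) x := by
  intro i
  induction i using Nat.strong_induction_on with
  | _ i ih =>
    refine toPrime_mem_domain hq ?_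
    rw [apply_algebraMap, baseCoord_iterate_step ih]
    exact hx i

variable [CharZero k]

theorem exists_orbitDefined (A : GL (Fin n) (RatFunc k)) :
    ∃ b : ℕ, ∀ B : GL (Fin n) k, OrbitDefined (comorphism A) (point (b : k) B) := by
  obtain ⟨q, hq, hA, hA'⟩ := exists_common_denominator A
  obtain ⟨b, hb⟩ := Filter.eventually_atTop.mp (eventually_eval_ne_zero hq)
  refine ⟨b, fun B => orbitDefined_of_eval_ne_zero
    (isDefinedOnBasicOpen_comorphism hq hA hA') fun i => ?_⟩
  rw [baseCoord_point, ← Nat.cast_add, ← eval₂_id]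
  exact hb _ (Nat.le_add_right b i)

section OrbitSeq

variable {x : CoordRing k n →ₐ[k] k} {b : ℕ}

theorem orbitSeq_algebraMap (hb : baseCoord x = b) (hx : OrbitDefined (comorphism A) x)
    (p : k[X]) : orbitSeq (comorphism A) x b (algebraMap k[X] (CoordRing k n) p) =
      algebraMap (RatFunc k) (SeqRing k) (algebraMap k[X] (RatFunc k) p) := by
  rw [algebraMap_polynomial, orbitSeq_apply, mk_eq_mk]
  filter_upwards [Filter.eventually_ge_atTop b] with m hm
  rw [apply_algebraMap, baseCoord_iterate_step fun j _ => hx j, hb, ← Nat.cast_add,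
    Nat.add_sub_cancel' hm]

theorem isFundamentalMatrix_orbitSeq (hb : baseCoord x = b) (hx : OrbitDefined (comorphism A) x) :
    IsFundamentalMatrix (shift k) A (map (orbitSeq (comorphism A) x b) (genericGL k n)) := by
  obtain ⟨q, hq, hA, -⟩ := exists_common_denominator A
  choose P hP using hA
  set O := orbitSeq (comorphism A) x b
  have O_algebraMap (p : k[X]) : O (algebraMap k[X] _ p) = algebraMap (RatFunc k) (SeqRing k)
      (algebraMap k[X] (RatFunc k) p) := orbitSeq_algebraMap hb hx p
  have isUnit_O_q : IsUnit (O (algebraMap k[X] _ q)) := by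
    rw [O_algebraMap]
    exact (IsUnit.mk0 _ (by simpa using hq)).map _
  refine Units.ext (Matrix.ext fun i j => isUnit_O_q.mul_left_injective ?_)
  calc shift k (O ((genericGL k n).val i j)) * O (algebraMap k[X] _ q)
      = O (∑ l, algebraMap k[X] _ (P i l) * (genericGL k n).val l j) :=
        shift_orbitSeq_mul_eq hx b (comorphism_genericGL_mul_algebraMap (hP i) j)
    _ = (∑ l, algebraMap (RatFunc k) (SeqRing k) (A.val i l) * O ((genericGL k n).val l j)) *
          O (algebraMap k[X] _ q) := by
        rw [map_sum, Finset.sum_mul]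
        refine Finset.sum_congr rfl fun l _ => ?_
        rw [map_mul, O_algebraMap, O_algebraMap, hP, Algebra.smul_def, map_mul, mul_assoc, mul_comm]

theorem mem_fractionSubalgebra_of_mem_entryAlgebra (hb : baseCoord x = b)
    (hx : OrbitDefined (comorphism A) x) {s : SeqRing k}
    (hs : s ∈ entryAlgebra (RatFunc k) (map (orbitSeq (comorphism A) x b) (genericGL k n))) :
    s ∈ fractionSubalgebra (subalgebraOfSubring (orbitSeq (comorphism A) x b).range) := by
  induction hs using Algebra.adjoin_induction with
  | mem s hs =>
    obtain ⟨⟨i, j⟩, rfl⟩ := hs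
    exact le_fractionSubalgebra ⟨(genericGL k n).val i j, rfl⟩
  | algebraMap h =>
    obtain ⟨p, q, hq, rfl⟩ := IsFractionRing.div_surjective k[X] h
    have hq' : algebraMap k[X] (RatFunc k) q ≠ 0 := by simpa using nonZeroDivisors.ne_zero hq
    refine ⟨_, ⟨algebraMap k[X] _ q, orbitSeq_algebraMap hb hx q⟩, (IsUnit.mk0 _ hq').map _,
      algebraMap k[X] _ p, ?_⟩
    rw [orbitSeq_algebraMap hb hx, ← map_mul, div_mul_cancel₀ _ hq']
  | add s t _ _ hs ht => exact add_mem hs ht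
  | mul s t _ _ hs ht => exact mul_mem hs ht

theorem hasPicardVessiotInSeq_iff (hb : baseCoord x = b) (hx : OrbitDefined (comorphism A) x) :
    HasPicardVessiotInSeq A ↔
      ∀ f, IsAssociatePeriodic (shift k) (orbitSeq (comorphism A) x b f) := by
  have hY := isFundamentalMatrix_orbitSeq hb hx
  constructor
  · intro h f
    obtain ⟨L, ⟨Z, hZ⟩, hper⟩ := h.exists_subalgebra hY
    refine hper _ (apply_mem_of_map_genericGL_mem (T := L.toSubring) (fun p => ?_) ?_ f)
    · exact orbitSeq_algebraMap hb hx p ▸ L.algebraMap_mem _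
    · exact hZ ▸ ⟨fun i j => (Z.val i j).2, fun i j => (Z⁻¹.val i j).2⟩
  · intro hper
    refine .of_isFundamentalMatrix hY fun s hs => isAssociatePeriodic_of_mem_fractionSubalgebra ?_ s
      (mem_fractionSubalgebra_of_mem_entryAlgebra hb hx hs)
    rintro _ ⟨f, rfl⟩
    exact hper f

end OrbitSeq

theorem forall_isFiniteUnionOfAP_returnSet_iff {b : ℕ} {B : GL (Fin n) k}
    (hx : OrbitDefined (comorphism A) (point (b : k) B)) :
    (∀ Y : Set (PrimeSpectrum (CoordRing k n)), IsClosed Y →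
      IsFiniteUnionOfAP (returnSet (comorphism A) (point (b : k) B) Y)) ↔
        HasPicardVessiotInSeq A :=
  (AffineRationalMap.forall_isFiniteUnionOfAP_returnSet_iff _ b).trans
    (hasPicardVessiotInSeq_iff (baseCoord_point _ B) hx).symm

end SkewMap

theorem mainTheorem1 {k : Type*} [Field k] [CharZero k] {n : ℕ} (A : GL (Fin n) (RatFunc k)) :
    List.TFAE [
      ∀ (b : ℕ) (B : GL (Fin n) k),
        AffineRationalMap.OrbitDefined (SkewMap.comorphism A) (SkewMap.point (b : k) B) →
        ∀ Y : Set (PrimeSpectrum (SkewMap.CoordRing k n)), IsClosed Y →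
          IsFiniteUnionOfAP
            (AffineRationalMap.returnSet (SkewMap.comorphism A) (SkewMap.point (b : k) B) Y),
      ∃ (b : ℕ) (B : GL (Fin n) k),
        AffineRationalMap.OrbitDefined (SkewMap.comorphism A) (SkewMap.point (b : k) B) ∧
        ∀ Y : Set (PrimeSpectrum (SkewMap.CoordRing k n)), IsClosed Y →
          IsFiniteUnionOfAP
            (AffineRationalMap.returnSet (SkewMap.comorphism A) (SkewMap.point (b : k) B) Y),
      HasPicardVessiotInSeq A] := by
  tfae_have 1 → 2 := fun h =>
    let ⟨b, hb⟩ := SkewMap.exists_orbitDefined A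
    ⟨b, 1, hb 1, h b 1 (hb 1)⟩
  tfae_have 2 → 3 := fun ⟨_, _, hx, h⟩ =>
    (SkewMap.forall_isFiniteUnionOfAP_returnSet_iff hx).mp h
  tfae_have 3 → 1 := fun h _ _ hx =>
    (SkewMap.forall_isFiniteUnionOfAP_returnSet_iff hx).mpr h
  tfae_finish
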